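/- Let $n\ge 1$, $s\in\mathbb R$, and let $X_1,\dots,X_n$ be real random variables that are conditionally independent given a random variable $\Theta\in\{0,1\}$ with $\Pr(\Theta=1)=1-\Pr(\Theta=0)=q$, $q>0$. Assume that exceedances of the level $s$ do not happen in phase $0$, i.e. $\Pr(X_i>s,\ \Theta=0)=0$ for all $i$, and that in phase $1$ all the variables have the same exceedance probability $p_1:=\Pr(X_i>s\mid\Theta=1)>0$, $1\le i\le n$ (as is the case when the $X_i$ are identically distributed). Let $N_{s,n}=\sum_{i=1}^n\mathbf 1_{\{X_i>s\}}$ be the number of exceedances and $\lambda=np_1$. Write $\mathcal L(N_{s,n}^{(1)})$ for the conditional law of $N_{s,n}$ given $N_{s,n}\ge1$, $\mathrm{Pn}^{(1)}(\lambda)$ for the conditional law of $P$ given $P\ge 1$, where $P$ is Poisson with mean $\lambda$, and $d_{TV}(Q_1,Q_2)=\sup_{A\subset\{1,2,\dots\}}|Q_1(A)-Q_2(A)|$. Then $$d_{TV}\big(\mathcal L(N_{s,n}^{(1)}),\mathrm{Pn}^{(1)}(\lambda)\big)\le \frac{p_1\,(1-e^{-\lambda}-\lambda e^{-\lambda})}{(1-e^{-\lambda})\,\big(1-(1-p_1)^n\big)}.$$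 Moreover, for fixed $n$, the right-hand side is asymptotically equivalent to $p_1/2$ as $p_1\downarrow0$ (the ratio of the two tends to $1$). -/

import Mathlib

open MeasureTheory Filter Topology
open scoped NNReal

noncomputable section

/-- The number `N_{s,n} = ∑ᵢ 1_{(s,∞)}(Xᵢ)` of exceedances of `X₁, …, Xₙ` above the level `s`. -/
def numExceedances {Ω : Type*} {n : ℕ} (X : Fin n → Ω → ℝ) (s : ℝ) (ω : Ω) : ℕ :=
  ∑ i, (Set.Ioi s).indicator (fun _ => 1) (X i ω)

/-- For a distribution `Q` on `{0, 1, 2, …}`, the distribution `Q^{(m)}` of `W` given `W ≥ m`,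
where `W ∼ Q`. -/
def condGE (m : ℕ) (Q : Measure ℕ) : Measure ℕ :=
  ProbabilityTheory.cond Q (Set.Ici m)

/-- The law of `W^{(m)}`, that is `ℒ(W | W ≥ m)`, for a random variable `W` with values
in `{0, 1, 2, …}`. -/
def condLaw {Ω : Type*} [MeasurableSpace Ω] (m : ℕ) (W : Ω → ℕ) (μ : Measure Ω) : Measure ℕ :=
  condGE m (μ.map W)

/-- The conditional Poisson distribution `Pn^{(m)}(r) = ℒ(P | P ≥ m)`, where `P ∼ Pn(r)`. -/
def condPoisson (m : ℕ) (r : ℝ≥0) : Measure ℕ :=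
  condGE m (ProbabilityTheory.poissonMeasure r)

/-- The total variation distance `sup {|Q₁(A) - Q₂(A)| : A ⊆ {m, m+1, …}}` between two
probability distributions on `{m, m+1, …}`. -/
def tvDist (m : ℕ) (Q₁ Q₂ : Measure ℕ) : ℝ :=
  ⨆ A : {A : Set ℕ // A ⊆ Set.Ici m}, |Q₁.real A.1 - Q₂.real A.1|

/-- The variables `Xᵢ` are conditionally independent given the discrete variable `Θ`: they are
independent under `μ(· | Θ = θ)` for every value `θ` that `Θ` takes with positive probability. -/
def CondIndepGiven {Ω ι κ : Type*} [MeasurableSpace Ω] (X : ι → Ω → ℝ) (Θ : Ω → κ)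
    (μ : Measure Ω) : Prop :=
  ∀ θ : κ, μ (Θ ⁻¹' {θ}) ≠ 0 →
    ProbabilityTheory.iIndepFun X (ProbabilityTheory.cond μ (Θ ⁻¹' {θ}))

/-- The error bound
`p (1 - e^{-r} - r e^{-r}) / ((1 - e^{-r}) (1 - (1 - p)^n))` with `r = n p`. -/
def phaseBound (n : ℕ) (p : ℝ) : ℝ :=
  p * (1 - Real.exp (-(n * p)) - n * p * Real.exp (-(n * p))) /
    ((1 - Real.exp (-(n * p))) * (1 - (1 - p) ^ n))

end

/-! Exceedances occur only in phase 1, so given `N ≥ 1` the phase may be taken to be 1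
(`condLaw_real_eq`); there `N` is a sum of independent Bernoulli variables with parameter `p`. Let
`π` be the conditional Poisson law with mean parameter `r = n p` and solve `r f(j+1) - j f(j) =
1_A(j) - π(A)` for `j ≥ 1` with `f 1 = 0`. The left side then vanishes at `j = 0`, so its
expectation at `N` is `P(N ∈ A, N ≥ 1) - π(A) P(N ≥ 1)`. Independence turns this expectation into
`p²` times a sum of `n` expected increments of `f`, each at most `(1 - π 1) / r`
(`integral_stein_le`, `exists_stein_solution`). Dividing `p (1 - π 1)` by `P(N ≥ 1) = 1 - (1 - p)^n`
gives the bound. -/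

/-! ### Stein's equation on the positive integers. -/

/-- Stein's equation for a distribution `π` on `{1, 2, …}` with `(j + 1) π (j + 1) = r π j`: every
set `A` has a solution `f` vanishing at `1`, whose increments are at most `(1 - π 1) / r`. -/
lemma exists_stein_solution {π : ℕ → ℝ} {r : ℝ} (hr : 0 < r) (h0 : π 0 = 0)
    (hpos : ∀ j, 0 < π (j + 1)) (hsum : HasSum π 1)
    (hrec : ∀ j : ℕ, ((j : ℝ) + 2) * π (j + 2) = r * π (j + 1)) (A : Set ℕ) :
    ∃ f : ℕ → ℝ, f 1 = 0 ∧
      (∀ j : ℕ, r * f (j + 2) - ((j : ℝ) + 1) * f (j + 1) =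
        A.indicator 1 (j + 1) - ∑' i, A.indicator π i) ∧
      ∀ j : ℕ, f (j + 2) - f (j + 1) ≤ (1 - π 1) / r := by
  have hnn : ∀ j, 0 ≤ π j := fun j => by
    cases j with
    | zero => exact h0.ge
    | succ j => exact (hpos j).le
  have hAnn : ∀ j, 0 ≤ A.indicator π j := fun j => Set.indicator_nonneg (fun j _ => hnn j) j
  have hAle : ∀ j, A.indicator π j ≤ π j := fun j => Set.indicator_le_self' (fun j _ => hnn j) j
  have hAsum : Summable (A.indicator π) := hsum.summable.indicator A
  set M := ∑' i, A.indicator π i with hM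
  set a : ℕ → ℝ := fun j => ∑ i ∈ Finset.range (j + 1), A.indicator π i with ha
  set L : ℕ → ℝ := fun j => ∑ i ∈ Finset.range (j + 1), π i with hL
  set g : ℕ → ℝ := fun j => a j - M * L j with hg
  have ha_succ : ∀ j, a (j + 1) = a j + A.indicator π (j + 1) := fun j =>
    Finset.sum_range_succ _ _
  have hL_succ : ∀ j, L (j + 1) = L j + π (j + 1) := fun j => Finset.sum_range_succ _ _
  have hL0 : L 0 = 0 := by simp [hL, h0]
  have ha0 : a 0 = 0 := le_antisymm (by simpa [ha, h0] using hAle 0) (by simpa [ha] using hAnn 0)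
  -- the part of `π` below `j`
  have hlow : ∀ j : ℕ, r * L j ≤ ((j : ℝ) + 1) * (L (j + 1) - π 1) := by
    intro j
    induction j with
    | zero => simp [hL_succ, hL0]
    | succ j ih =>
      have h1 : 0 ≤ L (j + 1) - π 1 := by
        have : π 1 ≤ L (j + 1) := Finset.single_le_sum (f := π) (fun i _ => hnn i) (by simp)
        linarith
      have := hrec j
      rw [hL_succ (j + 1), hL_succ j] at *
      push_cast
      nlinarith [hpos (j + 1)]
  have htail : ∀ j : ℕ, ∑' i, π (i + (j + 1)) = 1 - L j := fun j => by
    have := hsum.summable.sum_add_tsum_nat_add (j + 1)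
    rw [hsum.tsum_eq] at this
    simp only [hL]
    linarith
  have hsumm : ∀ j, Summable fun i => π (i + j) := fun j =>
    (summable_nat_add_iff j).2 hsum.summable
  -- the part of `π` above `j`
  have hhigh : ∀ j : ℕ, ((j : ℝ) + 1) * (1 - L (j + 1)) ≤ r * (1 - L j) := by
    intro j
    rw [← htail, ← htail, ← tsum_mul_left, ← tsum_mul_left]
    refine Summable.tsum_le_tsum (fun i => ?_) ((hsumm _).mul_left _) ((hsumm _).mul_left _)
    have := hrec (i + j)
    rw [show i + (j + 1) = i + j + 1 by ring, ← this, show i + (j + 1 + 1) = i + j + 2 by ring]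
    have h2 := (hpos (i + j + 1)).le
    have h3 : (0 : ℝ) ≤ i := by positivity
    push_cast
    exact mul_le_mul_of_nonneg_right (by linarith) h2
  have haM : ∀ j, a j ≤ M := fun j => hAsum.sum_le_tsum _ fun i _ => hAnn i
  -- Multiplying Stein's equation by `π` makes it telescope; `g` holds the partial sums of `(1_A -
  -- M) π`.
  refine ⟨fun j => g (j - 1) / (j * π j), by simp [hg, ha0, hL0], fun j => ?_, fun j => ?_⟩
  · have hp := (hpos j).ne'
    have hj : (j : ℝ) + 1 ≠ 0 := by positivity
    have e : A.indicator π (j + 1) = A.indicator 1 (j + 1) * π (j + 1) := by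
      by_cases h : j + 1 ∈ A <;> simp [h]
    have hg_succ : g (j + 1) - g j = (A.indicator 1 (j + 1) - M) * π (j + 1) := by
      simp only [hg, ha_succ, hL_succ, e]; ring
    have e2 : (((j + 2 : ℕ) : ℝ)) * π (j + 2) = r * π (j + 1) := by
      rw [← hrec]; push_cast; ring
    have e3 : ((j + 1 : ℕ) : ℝ) = j + 1 := by push_cast; ring
    simp only [e2, e3, Nat.add_sub_cancel, show ∀ j : ℕ, j + 2 - 1 = j + 1 from fun _ => rfl]
    have : r * (g (j + 1) / (r * π (j + 1))) - ((j : ℝ) + 1) * (g j / (((j : ℝ) + 1) * π (j + 1))) =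
        (g (j + 1) - g j) / π (j + 1) := by
      field_simp
    rw [this, hg_succ, mul_div_cancel_right₀ _ hp]
  · have hp := hpos j
    have e2 : (((j + 2 : ℕ) : ℝ)) * π (j + 2) = r * π (j + 1) := by
      rw [← hrec]; push_cast; ring
    have e3 : ((j + 1 : ℕ) : ℝ) = j + 1 := by push_cast; ring
    simp only [e2, e3, Nat.add_sub_cancel, show ∀ j : ℕ, j + 2 - 1 = j + 1 from fun _ => rfl]
    have hj : (0 : ℝ) < (j : ℝ) + 1 := by positivity
    have key : ((j : ℝ) + 1) * g (j + 1) - r * g j ≤ (1 - π 1) * (j + 1) * π (j + 1) := by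
      have hb : 0 ≤ M - a (j + 1) := sub_nonneg.2 (haM _)
      have hc1 := hAle (j + 1)
      have ha' : 0 ≤ a j := Finset.sum_nonneg fun i _ => hAnn i
      have h1 := hlow j
      have h2 := hhigh j
      have hT : 0 ≤ 1 - L (j + 1) := by
        rw [← htail]; exact tsum_nonneg fun i => hnn _
      have hL' : 0 ≤ L j := Finset.sum_nonneg fun i _ => hnn i
      have hπ1 : 0 < π 1 := hpos 0
      set c := A.indicator π (j + 1)
      obtain ⟨b, hbdef⟩ : ∃ b, b = M - a (j + 1) := ⟨_, rfl⟩
      have hMe : M = a j + c + b := by rw [hbdef, ha_succ]; ring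
      rw [← hbdef] at hb
      -- `M` splits into the mass of `A` below, at and above `j + 1`. The outer parts contribute
      -- nonpositively, by `hhigh` and `hlow`, so only the atom `c` can raise `f`.
      have e : ((j : ℝ) + 1) * g (j + 1) - r * g j =
          a j * ((j + 1) * (1 - L (j + 1)) - r * (1 - L j)) +
          c * ((j + 1) * (1 - L (j + 1)) + r * L j) - b * ((j + 1) * L (j + 1) - r * L j) := by
        simp only [hg, ha_succ, hMe]; ring
      have t1 : a j * ((j + 1) * (1 - L (j + 1)) - r * (1 - L j)) ≤ 0 :=
        mul_nonpos_of_nonneg_of_nonpos ha' (by linarith)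
      have t3 : 0 ≤ b * ((j + 1) * L (j + 1) - r * L j) := mul_nonneg hb (by nlinarith)
      have t2 : c * ((j + 1) * (1 - L (j + 1)) + r * L j) ≤
          π (j + 1) * ((j + 1) * (1 - π 1)) :=
        mul_le_mul hc1 (by linarith) (by positivity) hp.le
      rw [e]
      linarith
    have : g (j + 1) / (r * π (j + 1)) - g j / (((j : ℝ) + 1) * π (j + 1)) =
        (((j : ℝ) + 1) * g (j + 1) - r * g j) / (r * (((j : ℝ) + 1) * π (j + 1))) := by
      field_simp
    rw [this, div_le_div_iff₀ (by positivity) hr]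
    nlinarith

/-! ### The Stein-Chen estimate for Bernoulli sums. -/

lemma integrable_comp_of_le {Ω : Type*} [MeasurableSpace Ω] {ν : Measure Ω} [IsFiniteMeasure ν]
    {Z : Ω → ℕ} (hZ : Measurable Z) {n : ℕ} (hn : ∀ ω, Z ω ≤ n) (G : ℕ → ℝ) :
    Integrable (fun ω => G (Z ω)) ν := by
  refine Integrable.of_bound (C := ∑ k ∈ Finset.range (n + 1), |G k|)
    ((measurable_from_nat (f := G)).comp hZ).aestronglyMeasurable (ae_of_all _ fun ω => ?_)
  exact Finset.single_le_sum (f := fun k => |G k|) (fun k _ => abs_nonneg _)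
    (Finset.mem_range.2 (Nat.lt_succ_of_le (hn ω)))

/-- The Stein-Chen bound for a sum `∑ i, Y i` of independent Bernoulli variables with common
success probability `p`. -/
lemma integral_stein_le {Ω : Type*} [MeasurableSpace Ω] {ν : Measure Ω} [IsProbabilityMeasure ν]
    {n : ℕ} {Y : Fin n → Ω → ℕ} (hY : ∀ i, Measurable (Y i)) (hle : ∀ i ω, Y i ω ≤ 1)
    (hind : ProbabilityTheory.iIndepFun Y ν) {p : ℝ} (hp : ∀ i, ∫ ω, (Y i ω : ℝ) ∂ν = p)
    {f : ℕ → ℝ} {B : ℝ} (hf : ∀ j, f (j + 2) - f (j + 1) ≤ B) :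
    ∫ ω, (n * p * f (∑ i, Y i ω + 1) - (∑ i, Y i ω : ℕ) * f (∑ i, Y i ω)) ∂ν ≤
      n * p ^ 2 * B := by
  set W : Fin n → Ω → ℕ := fun i ω => ∑ j ∈ Finset.univ.erase i, Y j ω with hW
  have hWm : ∀ i, Measurable (W i) := fun i => Finset.measurable_fun_sum _ fun j _ => hY j
  have hWle : ∀ i ω, W i ω ≤ n := fun i ω =>
    (Finset.sum_le_card_nsmul _ _ 1 fun j _ => hle j ω).trans (by simp)
  have hN : ∀ i ω, ∑ j, Y j ω = W i ω + Y i ω := fun i ω =>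
    (Finset.sum_erase_add _ _ (Finset.mem_univ i)).symm
  have hindW : ∀ i, ProbabilityTheory.IndepFun (Y i) (W i) ν := fun i => by
    have := (hind.indepFun_finsetSum_of_notMem hY (Finset.notMem_erase i Finset.univ)).symm
    convert this using 1
    ext ω; simp [hW]
  -- Chosen so that `p f(N + 1) - Y f(N) = Y u(W) + p f(W + 1)` for `Y ∈ {0, 1}`; since `Y` and `W`
  -- are independent, the `f(W + 1)` terms cancel in expectation.
  set u : ℕ → ℝ := fun k => p * (f (k + 2) - f (k + 1)) - f (k + 1) with hu
  have hpt : ∀ ω, n * p * f (∑ i, Y i ω + 1) - (∑ i, Y i ω : ℕ) * f (∑ i, Y i ω) =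
      ∑ i, ((Y i ω : ℝ) * u (W i ω) + p * f (W i ω + 1)) := by
    intro ω
    have : ∀ i, (Y i ω : ℝ) * u (W i ω) + p * f (W i ω + 1) =
        p * f (∑ i, Y i ω + 1) - Y i ω * f (∑ i, Y i ω) := by
      intro i
      rw [hN i ω]
      rcases Nat.le_one_iff_eq_zero_or_eq_one.1 (hle i ω) with h | h
      · simp [h]
      · simp only [h, hu]; push_cast; ring_nf
    simp only [this, Finset.sum_sub_distrib, ← Finset.sum_mul]
    push_cast
    simp
  have hYint : ∀ i, Integrable (fun ω => (Y i ω : ℝ)) ν := fun i =>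
    integrable_comp_of_le (hY i) (hle i) fun k => (k : ℝ)
  have hWint : ∀ i (G : ℕ → ℝ), Integrable (fun ω => G (W i ω)) ν := fun i G =>
    integrable_comp_of_le (hWm i) (hWle i) G
  have hYW : ∀ i (G : ℕ → ℝ), ProbabilityTheory.IndepFun
      (fun ω => (Y i ω : ℝ)) (fun ω => G (W i ω)) ν := fun i G =>
    (hindW i).comp (φ := fun k : ℕ => (k : ℝ)) (ψ := G) measurable_from_nat measurable_from_nat
  have hprod : ∀ i, Integrable (fun ω => (Y i ω : ℝ) * u (W i ω)) ν := fun i =>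
    (hYW i u).integrable_mul (hYint i) (hWint i u)
  have hf1 : ∀ i, Integrable (fun ω => f (W i ω + 1)) ν := fun i => hWint i fun k => f (k + 1)
  have hd : ∀ i, Integrable (fun ω => f (W i ω + 2) - f (W i ω + 1)) ν := fun i =>
    hWint i fun k => f (k + 2) - f (k + 1)
  have hadd : ∀ i, Integrable (fun ω => (Y i ω : ℝ) * u (W i ω) + p * f (W i ω + 1)) ν :=
    fun i => (hprod i).add ((hf1 i).const_mul p)
  simp only [hpt]
  rw [integral_finsetSum _ fun i _ => hadd i]
  have hterm : ∀ i, ∫ ω, ((Y i ω : ℝ) * u (W i ω) + p * f (W i ω + 1)) ∂ν ≤ p ^ 2 * B := by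
    intro i
    rw [integral_add (hprod i) ((hf1 i).const_mul p), integral_const_mul,
      (hYW i u).integral_fun_mul_eq_mul_integral (hYint i).aestronglyMeasurable
        (hWint i u).aestronglyMeasurable, hp i]
    simp only [hu]
    rw [integral_sub ((hd i).const_mul p) (hf1 i), integral_const_mul]
    have h1 : ∫ ω, (f (W i ω + 2) - f (W i ω + 1)) ∂ν ≤ B := by
      calc _ ≤ ∫ _, B ∂ν := integral_mono (hd i) (integrable_const B) fun ω => hf _
        _ = B := by simp
    nlinarith [mul_le_mul_of_nonneg_left h1 (sq_nonneg p)]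
  calc _ ≤ ∑ _i : Fin n, p ^ 2 * B := Finset.sum_le_sum fun i _ => hterm i
    _ = n * p ^ 2 * B := by simp; ring

lemma hasSum_indicator_real (Q : Measure ℕ) [IsFiniteMeasure Q] (A : Set ℕ) :
    HasSum (A.indicator fun j => Q.real {j}) (Q.real A) := by
  have h := Q.tsum_indicator_apply_singleton A A.to_countable.measurableSet
  have hne : ∑' j, A.indicator (fun j => Q {j}) j ≠ ⊤ := h ▸ measure_ne_top Q A
  have h2 := ENNReal.hasSum_toReal hne
  rw [← ENNReal.tsum_toReal_eq fun j => ENNReal.ne_top_of_tsum_ne_top hne j, h] at h2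
  rw [measureReal_def]
  convert h2 using 1
  ext j
  by_cases hj : j ∈ A <;> simp [hj, measureReal_def]

lemma cond_real_apply_eq {Ω : Type*} [MeasurableSpace Ω] (μ : Measure Ω) {S : Set Ω}
    (hS : MeasurableSet S) (E : Set Ω) :
    (ProbabilityTheory.cond μ S).real E = (μ.real S)⁻¹ * μ.real (S ∩ E) := by
  simp [Measure.real, ProbabilityTheory.cond_apply hS]

/-! ### Asymptotics of the bound. -/

lemma phaseBound_isEquivalent {n : ℕ} (hn : 0 < n) :
    Asymptotics.IsEquivalent (𝓝[>] (0 : ℝ)) (fun p => phaseBound n p) (fun p => p / 2) := by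
  have hn' : (n : ℝ) ≠ 0 := by positivity
  have hexp : Tendsto (fun x : ℝ => (Real.exp x - 1 - x) / x ^ 2) (𝓝[≠] 0) (𝓝 (1 / 2)) := by
    have h := (Real.exp_sub_sum_range_succ_isLittleO_pow 2).tendsto_div_nhds_zero
    have h2 := (h.mono_left (nhdsWithin_le_nhds (s := {0}ᶜ))).add_const (1 / 2)
    rw [zero_add] at h2
    refine h2.congr' ?_
    filter_upwards [self_mem_nhdsWithin] with x hx
    have hx : x ≠ 0 := hx
    simp [Finset.sum_range_succ]
    field_simp
    ring
  have hr : Tendsto (fun p : ℝ => n * p) (𝓝[>] 0) (𝓝[≠] 0) := by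
    refine tendsto_nhdsWithin_iff.2 ⟨?_, ?_⟩
    · have : Tendsto (fun p : ℝ => n * p) (𝓝 0) (𝓝 (n * 0)) := (continuous_const_mul _).tendsto 0
      rw [mul_zero] at this
      exact this.mono_left nhdsWithin_le_nhds
    · filter_upwards [self_mem_nhdsWithin] with p hp
      exact mul_ne_zero hn' (ne_of_gt hp)
  have h1 : Tendsto (fun p : ℝ => (Real.exp (n * p) - 1 - n * p) / (n * p) ^ 2) (𝓝[>] 0)
      (𝓝 (1 / 2)) := hexp.comp hr
  have h2 : Tendsto (fun p : ℝ => (Real.exp (n * p) - 1) / (n * p)) (𝓝[>] 0) (𝓝 1) := by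
    have := (Real.hasDerivAt_exp 0).tendsto_slope_zero
    simp only [zero_add, Real.exp_zero, smul_eq_mul] at this
    refine (this.comp hr).congr fun p => ?_
    simp [div_eq_inv_mul]
  have h3 : Tendsto (fun p : ℝ => (1 - (1 - p) ^ n) / (n * p)) (𝓝[>] 0) (𝓝 1) := by
    have hd : HasDerivAt (fun p : ℝ => 1 - (1 - p) ^ n) (n : ℝ) 0 := by
      have := (((hasDerivAt_id (0 : ℝ)).const_sub 1).fun_pow n).const_sub 1
      simpa using this
    have := (hd.tendsto_slope_zero.mono_left (nhdsWithin_mono _ fun x hx => ne_of_gt hx :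
      𝓝[>] (0 : ℝ) ≤ 𝓝[≠] 0)).const_mul ((n : ℝ)⁻¹)
    rw [inv_mul_cancel₀ hn'] at this
    refine this.congr fun p => ?_
    simp [div_eq_inv_mul, mul_assoc]
    ring
  rw [Asymptotics.isEquivalent_iff_tendsto_one]
  · have h := (h1.div (h2.mul h3) (by norm_num)).const_mul 2
    norm_num at h
    refine h.congr' ?_
    filter_upwards [self_mem_nhdsWithin] with p hp
    have hp : 0 < p := hp
    have hE := Real.exp_pos (n * p)
    have hnp : (0 : ℝ) < n * p := by positivity
    have hE1 : Real.exp (n * p) - 1 ≠ 0 := by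
      have := Real.one_lt_exp_iff.2 hnp
      linarith
    simp only [Pi.div_apply, phaseBound, Real.exp_neg]
    -- Only `p > 0` is known here, so this factor may vanish (`p = 2`, `n` even); both sides are
    -- then `0` by division by zero.
    by_cases hz : 1 - (1 - p) ^ n = 0
    · simp [hz]
    · have e1 : 1 - (Real.exp (n * p))⁻¹ = (Real.exp (n * p) - 1) / Real.exp (n * p) := by
        field_simp
      have e2 : 1 - (Real.exp (n * p))⁻¹ - n * p * (Real.exp (n * p))⁻¹ =
          (Real.exp (n * p) - 1 - n * p) / Real.exp (n * p) := by
        field_simp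
      rw [e2, e1]
      field_simp
  · filter_upwards [self_mem_nhdsWithin] with p hp
    have hp : 0 < p := hp
    positivity

/-! ### The conditional Poisson law. -/

lemma condPoisson_real (r : ℝ≥0) (A : Set ℕ) :
    (condPoisson 1 r).real A =
      (1 - Real.exp (-r))⁻¹ * (ProbabilityTheory.poissonMeasure r).real (Set.Ici 1 ∩ A) := by
  have hI : (Set.Ici 1 : Set ℕ) = {0}ᶜ := by ext; simp [Nat.one_le_iff_ne_zero]
  have h : (ProbabilityTheory.poissonMeasure r).real (Set.Ici 1) = 1 - Real.exp (-r) := by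
    rw [hI, probReal_compl_eq_one_sub (measurableSet_singleton 0),
      ProbabilityTheory.poissonMeasure_real_singleton]
    simp
  rw [condPoisson, condGE, cond_real_apply_eq _ measurableSet_Ici, h]

lemma condPoisson_real_singleton_zero (r : ℝ≥0) : (condPoisson 1 r).real {0} = 0 := by
  rw [condPoisson_real]
  simp

lemma condPoisson_real_singleton_succ (r : ℝ≥0) (j : ℕ) :
    (condPoisson 1 r).real {j + 1} =
      (1 - Real.exp (-r))⁻¹ * (Real.exp (-r) * r ^ (j + 1) / (j + 1).factorial) := by
  rw [condPoisson_real, Set.inter_eq_right.2 (by simp),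
    ProbabilityTheory.poissonMeasure_real_singleton]

lemma isProbabilityMeasure_condPoisson {r : ℝ≥0} (hr : 0 < r) :
    IsProbabilityMeasure (condPoisson 1 r) := by
  refine ProbabilityTheory.cond_isProbabilityMeasure fun h => ?_
  have h1 : ProbabilityTheory.poissonMeasure r {1} = 0 := measure_mono_null (by simp) h
  have h2 := ProbabilityTheory.poissonMeasure_real_singleton_pos 1 hr
  simp [Measure.real, h1] at h2

/-- Conditioning only rescales the Poisson weights on `j ≥ 1`, so they keep the Poisson recursion.
-/
lemma exists_stein_solution_condPoisson {r : ℝ≥0} (hr : 0 < r) (A : Set ℕ) :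
    ∃ f : ℕ → ℝ, f 1 = 0 ∧
      (∀ j : ℕ, r * f (j + 2) - ((j : ℝ) + 1) * f (j + 1) =
        A.indicator 1 (j + 1) - (condPoisson 1 r).real A) ∧
      ∀ j : ℕ, f (j + 2) - f (j + 1) ≤ (1 - (condPoisson 1 r).real {1}) / r := by
  have := isProbabilityMeasure_condPoisson hr
  have hr' : (0 : ℝ) < r := hr
  have hexp : 0 < 1 - Real.exp (-r) := by simpa using hr
  rw [← (hasSum_indicator_real (condPoisson 1 r) A).tsum_eq]
  refine exists_stein_solution hr' (condPoisson_real_singleton_zero r) (fun j => ?_) ?_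
    (fun j => ?_) A
  · rw [condPoisson_real_singleton_succ]
    positivity
  · simpa using hasSum_indicator_real (condPoisson 1 r) Set.univ
  · rw [condPoisson_real_singleton_succ r j, condPoisson_real_singleton_succ r (j + 1),
      Nat.factorial_succ (j + 1)]
    push_cast
    field_simp
    ring

/-- The approximation error on a single set, for a sum of independent Bernoulli variables. -/
lemma real_sub_condPoisson_real_le {Ω : Type*} [MeasurableSpace Ω] {ν : Measure Ω}
    [IsProbabilityMeasure ν] {n : ℕ} {Y : Fin n → Ω → ℕ} (hY : ∀ i, Measurable (Y i))
    (hle : ∀ i ω, Y i ω ≤ 1) (hind : ProbabilityTheory.iIndepFun Y ν) {p : ℝ}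
    (hp : ∀ i, ∫ ω, (Y i ω : ℝ) ∂ν = p) (h0 : 0 < n * p) (A : Set ℕ) :
    ν.real ((fun ω => ∑ i, Y i ω) ⁻¹' (Set.Ici 1 ∩ A)) -
        (condPoisson 1 (n * p).toNNReal).real A *
          ν.real ((fun ω => ∑ i, Y i ω) ⁻¹' Set.Ici 1) ≤
      p * (1 - (condPoisson 1 (n * p).toNNReal).real {1}) := by
  have hr : 0 < (n * p).toNNReal := Real.toNNReal_pos.2 h0
  have hcoe : ((n * p).toNNReal : ℝ) = n * p := Real.coe_toNNReal _ h0.le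
  obtain ⟨f, hf1, hf2, hf3⟩ := exists_stein_solution_condPoisson hr A
  have hmain := integral_stein_le hY hle hind hp hf3
  rw [hcoe] at hf2 hmain
  set P := (condPoisson 1 (n * p).toNNReal).real A
  set N : Ω → ℕ := fun ω => ∑ i, Y i ω with hN
  have hNm : Measurable N := Finset.measurable_fun_sum _ fun i _ => hY i
  -- Where `N = 0` both sides vanish, the left one because `f 1 = 0`.
  have hpt : ∀ ω, n * p * f (∑ i, Y i ω + 1) - (∑ i, Y i ω : ℕ) * f (∑ i, Y i ω) =
      (N ⁻¹' (Set.Ici 1 ∩ A)).indicator 1 ω - P * (N ⁻¹' Set.Ici 1).indicator 1 ω := by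
    intro ω
    change n * p * f (N ω + 1) - (N ω : ℕ) * f (N ω) = _
    rcases h : N ω with _ | j
    · simp [Set.indicator, h, hf1]
    · have := hf2 j
      push_cast
      rw [this]
      by_cases hA : j + 1 ∈ A <;> simp [Set.indicator, h, hA]
  simp only [hpt] at hmain
  have hm1 : MeasurableSet (N ⁻¹' (Set.Ici 1 ∩ A)) := hNm .of_discrete
  have hm2 : MeasurableSet (N ⁻¹' Set.Ici 1) := hNm .of_discrete
  have hi : ∀ {E : Set Ω}, MeasurableSet E → Integrable (E.indicator (1 : Ω → ℝ)) ν :=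
    fun hE => (integrable_const (1 : ℝ)).indicator hE
  rw [integral_sub (hi hm1) ((hi hm2).const_mul P), integral_const_mul,
    integral_indicator_one hm1, integral_indicator_one hm2] at hmain
  refine hmain.trans_eq ?_
  have : (n : ℝ) * p ≠ 0 := h0.ne'
  have hn : (n : ℝ) ≠ 0 := left_ne_zero_of_mul this
  have hp : p ≠ 0 := right_ne_zero_of_mul this
  field_simp

/-! ### Reduction to phase 1 and conclusion. -/

/-- If the exceedances almost surely happen in `S` only, then conditioning on `S` does not change
the law of their number, given that it is positive. -/
lemma condLaw_real_eq {Ω : Type*} [MeasurableSpace Ω] {μ : Measure Ω} [IsProbabilityMeasure μ]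
    {N : Ω → ℕ} (hN : Measurable N) {S : Set Ω} (hS : MeasurableSet S) (hS0 : 0 < μ.real S)
    (h : ∀ᵐ ω ∂μ, ω ∉ S → N ω = 0) (A : Set ℕ) :
    (condLaw 1 N μ).real A =
      (ProbabilityTheory.cond μ S).real (N ⁻¹' (Set.Ici 1 ∩ A)) /
        (ProbabilityTheory.cond μ S).real (N ⁻¹' Set.Ici 1) := by
  have key : ∀ B ⊆ Set.Ici 1, μ.real (S ∩ N ⁻¹' B) = μ.real (N ⁻¹' B) := fun B hB => by
    refine measureReal_congr ?_
    filter_upwards [h] with ω hω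
    refine propext ⟨fun h => h.2, fun h' => ⟨?_, h'⟩⟩
    by_contra hs
    have h1 : 1 ≤ N ω := hB h'
    have := hω hs
    omega
  rw [condLaw, condGE, cond_real_apply_eq _ measurableSet_Ici, cond_real_apply_eq _ hS,
    cond_real_apply_eq _ hS, key _ Set.inter_subset_left, key _ subset_rfl,
    map_measureReal_apply hN .of_discrete, map_measureReal_apply hN .of_discrete]
  field_simp

lemma tvDist_numExceedances_le {Ω : Type*} [MeasurableSpace Ω] {μ : Measure Ω}
    [IsProbabilityMeasure μ] {n : ℕ} (hn : 0 < n) {X : Fin n → Ω → ℝ} {S : Set Ω} {s p : ℝ}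
    (hX : ∀ i, Measurable (X i)) (hS : MeasurableSet S) (hS0 : 0 < μ.real S)
    (hind : ProbabilityTheory.iIndepFun X (ProbabilityTheory.cond μ S))
    (h0 : ∀ i, ∀ᵐ ω ∂μ, ω ∉ S → X i ω ≤ s)
    (h1 : ∀ i, (ProbabilityTheory.cond μ S).real {ω | s < X i ω} = p) (hp : 0 < p) :
    tvDist 1 (condLaw 1 (numExceedances X s) μ) (condPoisson 1 (n * p).toNNReal) ≤
      phaseBound n p := by
  have hν : IsProbabilityMeasure (ProbabilityTheory.cond μ S) :=
    ProbabilityTheory.cond_isProbabilityMeasure fun h => by simp [Measure.real, h] at hS0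
  have hQ := condLaw_real_eq (μ := μ) (N := numExceedances X s) (S := S)
  set ν := ProbabilityTheory.cond μ S
  set Y : Fin n → Ω → ℕ := fun i ω => (Set.Ioi s).indicator (fun _ => 1) (X i ω) with hYdef
  have hg : Measurable ((Set.Ioi s).indicator (fun _ => 1) : ℝ → ℕ) :=
    measurable_const.indicator measurableSet_Ioi
  have hY : ∀ i, Measurable (Y i) := fun i => hg.comp (hX i)
  have hle : ∀ i ω, Y i ω ≤ 1 := fun i ω => by
    simp only [hYdef, Set.indicator]; split_ifs <;> simp
  have hindY : ProbabilityTheory.iIndepFun Y ν := hind.comp _ fun _ => hg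
  have hE : ∀ i, MeasurableSet {ω | s < X i ω} := fun i => measurableSet_lt measurable_const (hX i)
  have hpY : ∀ i, ∫ ω, (Y i ω : ℝ) ∂ν = p := fun i => by
    rw [← h1 i, ← integral_indicator_one (hE i)]
    refine integral_congr_ae (ae_of_all _ fun ω => ?_)
    by_cases h : s < X i ω <;> simp [hYdef, Set.indicator, h]
  have hnp : 0 < n * p := by positivity
  have hN : Measurable (numExceedances X s) := Finset.measurable_fun_sum _ fun i _ => hY i
  have hae : ∀ᵐ ω ∂μ, ω ∉ S → numExceedances X s ω = 0 := by
    filter_upwards [ae_all_iff.2 h0] with ω hω hs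
    exact Finset.sum_eq_zero fun i _ => by simp [hω i hs]
  replace hQ := hQ hN hS hS0 hae
  -- the probability of at least one exceedance
  have hD : ν.real (numExceedances X s ⁻¹' Set.Ici 1) = 1 - (1 - p) ^ n := by
    have hc : numExceedances X s ⁻¹' Set.Ici 1 = (⋂ i, {ω | s < X i ω}ᶜ)ᶜ := by
      ext ω
      simp [numExceedances, Nat.one_le_iff_ne_zero, Set.indicator]
    have hI : ν.real (⋂ i, {ω | s < X i ω}ᶜ) = ∏ i, ν.real {ω | s < X i ω}ᶜ := by
      have := hind.meas_iInter (s := fun i => {ω | s < X i ω}ᶜ)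
        fun i => ⟨(Set.Ioi s)ᶜ, measurableSet_Ioi.compl, rfl⟩
      simp only [Measure.real, this, ENNReal.toReal_prod]
    rw [hc, probReal_compl_eq_one_sub (MeasurableSet.iInter fun i => (hE i).compl), hI]
    simp [probReal_compl_eq_one_sub (hE _), h1]
  have hp1 : p ≤ 1 := h1 ⟨0, hn⟩ ▸ measureReal_le_one
  have hDpos : 0 < 1 - (1 - p) ^ n :=
    sub_pos.2 (pow_lt_one₀ (by linarith) (by linarith) hn.ne')
  have hPprob := isProbabilityMeasure_condPoisson (Real.toNNReal_pos.2 hnp)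
  have hone : ∀ A : Set ℕ, (condLaw 1 (numExceedances X s) μ).real A -
      (condPoisson 1 (n * p).toNNReal).real A ≤ phaseBound n p := fun A => by
    have h := real_sub_condPoisson_real_le hY hle hindY hpY hnp A
    change ν.real (numExceedances X s ⁻¹' (Set.Ici 1 ∩ A)) -
      _ * ν.real (numExceedances X s ⁻¹' Set.Ici 1) ≤ _ at h
    have h2 := condPoisson_real_singleton_succ (n * p).toNNReal 0
    rw [Real.coe_toNNReal _ hnp.le] at h2
    have hexp : 0 < 1 - Real.exp (-(n * p)) := by simpa using hnp
    have hb : phaseBound n p =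
        p * (1 - (condPoisson 1 (n * p).toNNReal).real {1}) / (1 - (1 - p) ^ n) := by
      rw [zero_add] at h2
      rw [h2, phaseBound]
      simp only [pow_one, Nat.factorial_one, Nat.cast_one, div_one]
      generalize Real.exp (-(n * p)) = x at hexp ⊢
      have := hexp.ne'
      field_simp
    rw [hb, le_div_iff₀ hDpos, hQ, hD, sub_mul, div_mul_cancel₀ _ hDpos.ne', ← hD]
    exact h
  have hQprob : IsProbabilityMeasure (condLaw 1 (numExceedances X s) μ) := by
    refine ⟨?_⟩
    have h := hQ Set.univ
    rw [Set.inter_univ, hD, div_self hDpos.ne'] at h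
    rw [← ENNReal.toReal_eq_one_iff]
    exact h
  have : Nonempty {A : Set ℕ // A ⊆ Set.Ici 1} := ⟨⟨∅, Set.empty_subset _⟩⟩
  -- Both laws are probability measures, so the one-sided bound for the complement of `A` is the
  -- lower bound for `A`.
  refine ciSup_le fun A => abs_le.2 ⟨?_, hone A⟩
  have h := hone A.1ᶜ
  rw [probReal_compl_eq_one_sub .of_discrete, probReal_compl_eq_one_sub .of_discrete] at h
  linarith

theorem mainTheorem12 (n : ℕ) (hn : 0 < n) :
    (∀ (Ω : Type*) [MeasurableSpace Ω] (μ : Measure Ω) [IsProbabilityMeasure μ]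
      (X : Fin n → Ω → ℝ) (Θ : Ω → Fin 2) (s q p₁ : ℝ),
      (∀ i, Measurable (X i)) → Measurable Θ →
      -- the phase variable is Bernoulli with parameter `q > 0`
      μ.real (Θ ⁻¹' {1}) = q → 0 < q →
      CondIndepGiven X Θ μ →
      -- no exceedances in phase `0`
      (∀ i, ∀ᵐ ω ∂μ, Θ ω = 0 → X i ω ≤ s) →
      -- common exceedance probability in phase `1`
      (∀ i, (ProbabilityTheory.cond μ (Θ ⁻¹' {1})).real {ω | s < X i ω} = p₁) → 0 < p₁ →
      tvDist 1 (condLaw 1 (numExceedances X s) μ) (condPoisson 1 (n * p₁).toNNReal)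
        ≤ phaseBound n p₁) ∧
    Asymptotics.IsEquivalent (𝓝[>] (0 : ℝ)) (fun p => phaseBound n p) (fun p => p / 2) := by
  refine ⟨?_, phaseBound_isEquivalent hn⟩
  intro Ω _ μ _ X Θ s q p₁ hX hΘ hq hq0 hind h0 h1 hp
  refine tvDist_numExceedances_le hn hX (hΘ (measurableSet_singleton 1)) (hq ▸ hq0)
    (hind 1 fun h => ?_) (fun i => ?_) h1 hp
  · simp [Measure.real, h] at hq
    exact hq0.ne hq
  · filter_upwards [h0 i] with ω hω hs
    refine hω ?_
    have : Θ ω ≠ 1 := hs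
    omega
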